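/- Let $X$ be a real Banach space with closed unit ball $B_X$, and for a subset $E$ of a real topological vector space let $\operatorname{co}(E)$ be its convex hull, $\overline{\operatorname{co}}(E)$ the closure of $\operatorname{co}(E)$, and, if $E$ is convex, $\operatorname{Ext}(E)$ its set of extreme points. For a nonempty bounded $A\subseteq X$, a slice of $A$ is a set $\{a\in A: f(a)>\sup f(A)-\delta\}$ with $f\in X^*$, $\|f\|\le 1$ and $\delta>0$; $A$ is dentable if for every $\varepsilon>0$ it has a slice of diameter at most $\varepsilon$, and nondentable otherwise. A weak denting point of a set $E\subseteq X$ is a point $e\in E$ such that $e$ is not in the weak closure of $\operatorname{co}(E\setminus U)$, for every weak neighborhood $U$ of $e$. For every nonempty nondentable set $A\subseteq B_X$ there is a countably infinite set $F\subseteq\overline{\operatorname{co}}(A)$ such that: 1. $\lim_{F\ni f\to\infty} d(f,A)=0$, i.e. for every $\eta>0$ all but finitely many $f\in F$ satisfy $d(f,A)<\eta$; 2. $F$ is closed and discrete in the weak topology of $X$, and $F$ has no extreme points, in the sense that no point of $F$ is an extreme point of $\operatorname{co}(F)$ (equivalently, every $x\in F$ lies in $\operatorname{co}(F\setminus\{x\})$);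 3. $\overline{\operatorname{co}}(F)$ has no weak denting point; 4. $\overline{\operatorname{co}}(F)\cap\operatorname{Ext}\big(\overline{\operatorname{co}}^{w^*}(F)\big)=\emptyset$, where $X$ is regarded as a subspace of $X^{**}$ and $\overline{\operatorname{co}}^{w^*}(F)$ is the weak*-closure of $\operatorname{co}(F)$ in $X^{**}$. -/

import Mathlib

open Set Filter Topology

noncomputable section

/-- The slice `S(f, A, δ) = {a ∈ A : f(a) > sup f(A) - δ}`. -/
def slice {X : Type*} [NormedAddCommGroup X] [NormedSpace ℝ X]
    (f : StrongDual ℝ X) (A : Set X) (δ : ℝ) : Set X :=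
  {a ∈ A | sSup (f '' A) - δ < f a}

/-- A bounded nonempty set is `ε`-dentable if it has a slice, by a functional in the closed unit
ball of the dual, of diameter at most `ε`. -/
def IsEpsDentable {X : Type*} [NormedAddCommGroup X] [NormedSpace ℝ X]
    (A : Set X) (ε : ℝ) : Prop :=
  ∃ f : StrongDual ℝ X, ‖f‖ ≤ 1 ∧ ∃ δ : ℝ, 0 < δ ∧ Metric.diam (slice f A δ) ≤ ε

/-- A bounded nonempty set is dentable if it is `ε`-dentable for every `ε > 0`. -/
def IsDentable {X : Type*} [NormedAddCommGroup X] [NormedSpace ℝ X] (A : Set X) : Prop :=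
  ∀ ε : ℝ, 0 < ε → IsEpsDentable A ε

/-- The closed convex hull, in a real topological vector space `V`. -/
def cco {V : Type*} [AddCommGroup V] [Module ℝ V] [TopologicalSpace V] (E : Set V) : Set V :=
  closure (convexHull ℝ E)

/-- `e` is a denting point of `E` (for the topology of `V`): `e ∈ E` and `e` is not in the closed
convex hull of `E \ U`, for every neighborhood `U` of `e`. With `V = WeakSpace ℝ X` these are the
weak denting points. -/
def IsDentingPoint {V : Type*} [AddCommGroup V] [Module ℝ V] [TopologicalSpace V]
    (E : Set V) (e : V) : Prop :=
  e ∈ E ∧ ∀ U ∈ 𝓝 e, e ∉ cco (E \ U)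

/-- The extreme points of a set that need not be convex: the points of `E` that are extreme in
the convex hull of `E`, i.e. that are not convex combinations of other points of `E`. -/
def hullExtremePoints {V : Type*} [AddCommGroup V] [Module ℝ V] (E : Set V) : Set V :=
  E ∩ (convexHull ℝ E).extremePoints ℝ

/-- On convex sets these are the usual extreme points. -/
theorem hullExtremePoints_eq_of_convex {V : Type*} [AddCommGroup V] [Module ℝ V] {E : Set V}
    (hE : Convex ℝ E) : hullExtremePoints E = E.extremePoints ℝ := by
  unfold hullExtremePoints
  rw [hE.convexHull_eq]
  exact inter_eq_right.mpr extremePoints_subset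

end

/-! Nondentability lets one grow a bush in `A` whose new branches keep a fixed distance from
everything built before. By `exists_subslice_disjoint_closedBall`, a form of Namioka's superlemma,
slices of `cco A` can be shrunk away from any compact set. Hahn-Banach turns this into
`SliceNode.IsDeep.exists_convexHull_refinements`: a point deep in a slice is nearly a convex
combination of points of `A`, each deep in a subslice that avoids the hull of the points chosen so
far. Iteration gives finite levels with summable errors, and averaging over ever later descendants
converges to an exact bush. Its set of values is `F`.

Values approach the corresponding points of `A` as the level grows. Each value is a convex
combination of its children, all different from it, so `F` has no extreme points. A point near the
hull of the points up to level `m` has a weak neighborhood missing the finitely many closed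
half-spaces of level `m + 1`, which cover all later values; any other point is separated from `F` by
a weakly closed convex set. Hence `F` is weakly closed and discrete.

The remaining claims are formal. A denting point of the hull would have to lie in `F`, where it is a
combination of other points of `F`. By Milman's theorem an extreme point of the weak-star hull that
lies in `X` is in the weak closure of `F`, hence in `F`, and would be extreme there. -/

/-! ### Slices of nondentable sets -/

section Geometry

/-- A point in the convex hull of a union lies in the hull of one part or on a segment between
the two hulls. -/
theorem exists_of_mem_convexHull_union {V : Type*} [AddCommGroup V] [Module ℝ V] {S T : Set V}
    (hS : S.Nonempty) {x : V} (hx : x ∈ convexHull ℝ (S ∪ T)) :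
    x ∈ convexHull ℝ S ∨ ∃ a ∈ convexHull ℝ S, ∃ b ∈ convexHull ℝ T, ∃ t : ℝ,
      0 ≤ t ∧ t ≤ 1 ∧ x = (1 - t) • a + t • b := by
  rcases T.eq_empty_or_nonempty with rfl | hT
  · left; simpa using hx
  · right
    rw [convexHull_union hS hT, mem_convexJoin] at hx
    obtain ⟨a, ha, b, hb, s, t, hs, ht, hst, rfl⟩ := hx
    exact ⟨a, ha, b, hb, t, ht, by linarith, by rw [← hst]; simp⟩

variable {X : Type*} [NormedAddCommGroup X] [NormedSpace ℝ X]

theorem convex_cco (E : Set X) : Convex ℝ (cco E) := (convex_convexHull ℝ E).closure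

theorem subset_cco (E : Set X) : E ⊆ cco E :=
  (subset_convexHull ℝ E).trans subset_closure

theorem cco_subset {E D : Set X} (hED : E ⊆ D) (hD : Convex ℝ D) (hc : IsClosed D) :
    cco E ⊆ D :=
  closure_minimal (convexHull_min hED hD) hc

theorem exists_mem_lt_of_mem_cco {E : Set X} {f : StrongDual ℝ X} {c : ℝ} {x : X}
    (hx : x ∈ cco E) (hc : c < f x) : ∃ a ∈ E, c < f a := by
  by_contra! h
  have : cco E ⊆ {y | f y ≤ c} :=
    cco_subset h (convex_halfSpace_le f.isLinear c) (isClosed_le f.continuous continuous_const)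
  exact absurd (this hx) (not_le.mpr hc)

/-- In a nondentable set all nonempty open slices have diameter bounded away from zero. -/
theorem exists_lt_diam_of_not_isDentable {A : Set X} (hA : ¬ IsDentable A)
    (hb : Bornology.IsBounded A) :
    ∃ ε : ℝ, 0 < ε ∧ ∀ (f : StrongDual ℝ X) (c : ℝ), (∃ x ∈ A, c < f x) →
      ε < Metric.diam {a ∈ A | c < f a} := by
  simp only [IsDentable, not_forall] at hA
  obtain ⟨ε, hε, hA⟩ := hA
  refine ⟨ε, hε, fun f c ⟨x, hxA, hx⟩ => ?_⟩
  have hb' : Bornology.IsBounded {a ∈ A | c < f a} := hb.subset (sep_subset _ _)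
  by_contra! hle
  apply hA
  -- Dentability only tests functionals of norm at most one, so `f` is normalised; the zero
  -- functional cuts out all of `A`.
  by_cases hf : f = 0
  · refine ⟨0, by simp, 1, one_pos, le_trans (Metric.diam_mono ?_ hb') hle⟩
    rintro a ⟨ha, -⟩
    refine ⟨ha, ?_⟩
    simpa [hf] using hx
  · have hn : 0 < ‖f‖ := norm_pos_iff.mpr hf
    set g : StrongDual ℝ X := ‖f‖⁻¹ • f with hg
    have hgf : ∀ y, f y = ‖f‖ * g y := fun y => by simp [hg, hn.ne']
    have hbdd : BddAbove (g '' A) := (g.lipschitz.isBounded_image hb).bddAbove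
    have hxs : g x ≤ sSup (g '' A) := le_csSup hbdd (mem_image_of_mem g hxA)
    have hcx : c / ‖f‖ < g x := by
      rw [div_lt_iff₀ hn, mul_comm, ← hgf]; exact hx
    refine ⟨g, by simp [hg, norm_smul, hn.ne'], sSup (g '' A) - c / ‖f‖, by linarith,
      le_trans (Metric.diam_mono ?_ hb') hle⟩
    rintro a ⟨ha, hga⟩
    refine ⟨ha, ?_⟩
    rw [sub_sub_cancel, div_lt_iff₀ hn, mul_comm, ← hgf] at hga
    exact hga

/-- If all nonempty open slices of `A` have diameter greater than `ε`, every nonempty open slice of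
the closed convex hull contains another one that misses a given ball of radius `ε / 4`. -/
theorem exists_subslice_disjoint_closedBall {A : Set X} (hAB : A ⊆ Metric.closedBall (0 : X) 1)
    {ε : ℝ} (hε : 0 < ε)
    (hA : ∀ (f : StrongDual ℝ X) (c : ℝ), (∃ x ∈ A, c < f x) →
      ε < Metric.diam {a ∈ A | c < f a})
    (h : StrongDual ℝ X) (c : ℝ) (hc : ∃ x ∈ cco A, c < h x) (p : X) :
    ∃ (f : StrongDual ℝ X) (d : ℝ), (∃ x ∈ cco A, d < f x) ∧
      ∀ x ∈ cco A, d < f x → c < h x ∧ ε / 4 < dist x p := by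
  by_contra! hno
  have hCB : cco A ⊆ Metric.closedBall (0 : X) 1 :=
    cco_subset hAB (convex_closedBall _ _) Metric.isClosed_closedBall
  set C0 : Set X := cco A ∩ Metric.closedBall p (ε / 4) with hC0
  set C1 : Set X := cco A ∩ {x | h x ≤ c} with hC1
  have hcv0 : Convex ℝ C0 := (convex_cco A).inter (convex_closedBall _ _)
  have hcv1 : Convex ℝ C1 := (convex_cco A).inter (convex_halfSpace_le h.isLinear c)
  have hC0ne : C0.Nonempty := by
    obtain ⟨x, hx, hx1, hx2⟩ := hno h c hc
    exact ⟨x, hx, hx2 hx1⟩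
  -- By assumption `C0 ∪ C1` meets every slice of `cco A`, so Hahn-Banach leaves no point outside
  -- its closed hull.
  have hsub : cco A ⊆ closure (convexHull ℝ (C0 ∪ C1)) := by
    intro x hx
    by_contra hxn
    obtain ⟨f, d, hfd, hdx⟩ := geometric_hahn_banach_closed_point
      (convex_convexHull ℝ (C0 ∪ C1)).closure isClosed_closure hxn
    obtain ⟨y, hy, hdy, hy2⟩ := hno f d ⟨x, hx, hdx⟩
    have hyn : y ∉ C0 ∪ C1 := fun hy' =>
      absurd (hfd y (subset_closure (subset_convexHull ℝ _ hy'))) (not_lt.mpr hdy.le)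
    refine hyn ?_
    by_cases hcy : c < h y
    · exact Or.inl ⟨hy, hy2 hcy⟩
    · exact Or.inr ⟨hy, not_lt.mp hcy⟩
  have hbdd : BddAbove (h '' A) :=
    (h.lipschitz.isBounded_image (Metric.isBounded_closedBall.subset hAB)).bddAbove
  set M := sSup (h '' A) with hM
  have hAM : ∀ x ∈ A, h x ≤ M := fun x hx => le_csSup hbdd (mem_image_of_mem h hx)
  have hCM : ∀ x ∈ cco A, h x ≤ M := fun x hx => by
    by_contra! hlt
    obtain ⟨a, ha, hlt⟩ := exists_mem_lt_of_mem_cco hx hlt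
    exact absurd (hAM a ha) (not_le.mpr hlt)
  obtain ⟨x₀, hx₀, hcx₀⟩ := hc
  have hcM : c < M := hcx₀.trans_le (hCM x₀ hx₀)
  -- Near the top of `h` the weight on `C1` is below `τ`, so the slice lies within `2 * τ` of `C0`.
  -- The resulting diameter bound `2 * (ε / 4 + 2 * τ) = 3 * ε / 4` is less than `ε`.
  set τ : ℝ := ε / 16 with hτ
  have hτ0 : 0 < τ := by positivity
  set m : ℝ := M - τ * (M - c) with hm
  have hmM : m < M := by
    have := mul_pos hτ0 (sub_pos.mpr hcM); linarith
  have hex : ∃ x ∈ A, m < h x := by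
    have hAne : (h '' A).Nonempty := by
      obtain ⟨a, ha, -⟩ := exists_mem_lt_of_mem_cco hx₀ hcx₀
      exact ⟨_, mem_image_of_mem h ha⟩
    obtain ⟨_, ⟨a, ha, rfl⟩, hlt⟩ := exists_lt_of_lt_csSup hAne hmM
    exact ⟨a, ha, hlt⟩
  have hnear : ∀ u ∈ convexHull ℝ (C0 ∪ C1), m < h u → dist u p ≤ ε / 4 + 2 * τ := by
    intro u hu hmu
    rcases exists_of_mem_convexHull_union hC0ne hu with hu | ⟨a, ha, b, hb, t, ht0, ht1, rfl⟩
    · rw [hcv0.convexHull_eq] at hu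
      have := Metric.mem_closedBall.mp hu.2
      linarith
    · rw [hcv0.convexHull_eq] at ha
      rw [hcv1.convexHull_eq] at hb
      have h1 : h a ≤ M := hCM a ha.1
      have h2 : h b ≤ c := hb.2
      have h3 : m < (1 - t) * h a + t * h b := by simpa using hmu
      have h4 : (1 - t) * h a ≤ (1 - t) * M := mul_le_mul_of_nonneg_left h1 (by linarith)
      have h5 : t * h b ≤ t * c := mul_le_mul_of_nonneg_left h2 ht0
      have h6 : t < τ := by
        have : t * (M - c) < τ * (M - c) := by rw [hm] at h3; nlinarith
        exact lt_of_mul_lt_mul_right this (by linarith)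
      have h7 : dist ((1 - t) • a + t • b) a ≤ 2 * τ := by
        rw [dist_eq_norm]
        have : (1 - t) • a + t • b - a = t • (b - a) := by module
        rw [this, norm_smul, Real.norm_of_nonneg ht0]
        have ha1 : ‖a‖ ≤ 1 := by simpa using hCB ha.1
        have hb1 : ‖b‖ ≤ 1 := by simpa using hCB hb.1
        have : ‖b - a‖ ≤ 2 := (norm_sub_le _ _).trans (by linarith)
        nlinarith [norm_nonneg (b - a)]
      have h8 := Metric.mem_closedBall.mp ha.2
      linarith [dist_triangle ((1 - t) • a + t • b) a p]
  have hnear' : ∀ u ∈ A, m < h u → dist u p ≤ ε / 4 + 2 * τ := by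
    intro u hu hmu
    have hmem : u ∈ closure ({x | m < h x} ∩ convexHull ℝ (C0 ∪ C1)) :=
      (isOpen_lt continuous_const h.continuous).inter_closure ⟨hmu, hsub (subset_cco A hu)⟩
    have hcl : IsClosed {x : X | dist x p ≤ ε / 4 + 2 * τ} := Metric.isClosed_closedBall
    exact closure_minimal (fun x hx => hnear x hx.2 hx.1) hcl hmem
  have hdiam : Metric.diam {a ∈ A | m < h a} ≤ 2 * (ε / 4 + 2 * τ) := by
    refine Metric.diam_le_of_subset_closedBall (by positivity) (x := p) ?_
    exact fun u hu => hnear' u hu.1 hu.2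
  have := hA h m hex
  rw [hτ] at hdiam
  linarith

/-- Cover `K` by finitely many balls of radius `ε / 8` and avoid the concentric balls of radius `ε /
4` one at a time. -/
theorem exists_subslice_disjoint_thickening {A : Set X}
    (hAB : A ⊆ Metric.closedBall (0 : X) 1) {ε : ℝ} (hε : 0 < ε)
    (hA : ∀ (f : StrongDual ℝ X) (c : ℝ), (∃ x ∈ A, c < f x) →
      ε < Metric.diam {a ∈ A | c < f a})
    (h : StrongDual ℝ X) (c : ℝ) (hc : ∃ x ∈ cco A, c < h x) {K : Set X} (hK : IsCompact K) :
    ∃ (f : StrongDual ℝ X) (d : ℝ), (∃ x ∈ cco A, d < f x) ∧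
      ∀ x ∈ cco A, d < f x → c < h x ∧ x ∉ Metric.thickening (ε / 8) K := by
  obtain ⟨t, -, htf, htK⟩ := hK.finite_cover_balls (e := ε / 8) (by positivity)
  have key : ∀ s : Set X, s.Finite → ∃ (f : StrongDual ℝ X) (d : ℝ),
      (∃ x ∈ cco A, d < f x) ∧ ∀ x ∈ cco A, d < f x → c < h x ∧ ∀ p ∈ s, ε / 4 < dist x p := by
    intro s hs
    induction s, hs using Set.Finite.induction_on with
    | empty => exact ⟨h, c, hc, fun x _ hx => ⟨hx, by simp⟩⟩
    | @insert p s _ _ ih =>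
      obtain ⟨f, d, hd, hfd⟩ := ih
      obtain ⟨f', d', hd', hfd'⟩ := exists_subslice_disjoint_closedBall hAB hε hA f d hd p
      refine ⟨f', d', hd', fun x hx hdx => ?_⟩
      have h1 := hfd' x hx hdx
      have h2 := hfd x hx h1.1
      refine ⟨h2.1, ?_⟩
      rintro q (rfl | hq)
      · exact h1.2
      · exact h2.2 q hq
  obtain ⟨f, d, hd, hfd⟩ := key t htf
  refine ⟨f, d, hd, fun x hx hdx => ⟨(hfd x hx hdx).1, fun hxK => ?_⟩⟩
  obtain ⟨z, hz, hxz⟩ := Metric.mem_thickening_iff.mp hxK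
  obtain ⟨p, hp, hzp⟩ := mem_iUnion₂.mp (htK hz)
  have := (hfd x hx hdx).2 p hp
  have hzp := Metric.mem_ball.mp hzp
  linarith [dist_triangle x z p]

end Geometry

/-! ### Approximating a deep point by points in finer slices -/

section Refinement

/-- A point together with an open half-space `{z | bound < functional z}`. -/
structure SliceNode (X : Type*) [NormedAddCommGroup X] [NormedSpace ℝ X] where
  point : X
  functional : StrongDual ℝ X
  bound : ℝ

variable {X : Type*} [NormedAddCommGroup X] [NormedSpace ℝ X]

/-- The point of the node lies in `A`, and lies so deep in the slice of `A` determined by the node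
that any convex combination close to it gives weight of order `η` to the complement. -/
def SliceNode.IsDeep (A : Set X) (η : ℝ) (ν : SliceNode X) : Prop :=
  ν.point ∈ A ∧ ∃ M : ℝ, (∀ a ∈ A, ν.functional a ≤ M) ∧ ν.bound < M ∧
    M - ν.functional ν.point ≤ η * (M - ν.bound)

/-- The slice of `ν'` is contained in the slice of `ν` and stays strictly away from the
`δ`-thickening of `K`. -/
def SliceNode.IsRefinement (A : Set X) (δ : ℝ) (K : Set X) (ν ν' : SliceNode X) : Prop :=
  (∀ z ∈ cco A, ν'.bound < ν'.functional z → ν.bound < ν.functional z) ∧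
    ∃ d < ν'.bound, ∀ z ∈ cco A, z ∈ Metric.thickening δ K → ν'.functional z ≤ d

theorem SliceNode.IsDeep.bound_lt {A : Set X} {η : ℝ} {ν : SliceNode X} (h : ν.IsDeep A η)
    (hη : η < 1) : ν.bound < ν.functional ν.point := by
  obtain ⟨-, M, -, hM, hdeep⟩ := h
  nlinarith

/-- A point outside the right-hand side would be cut off by a slice disjoint from it. Shrinking that
slice away from `K` and choosing a point of `A` near its top gives a refinement whose point should
have been on the right-hand side. -/
theorem cco_subset_cco_refinements_union {A : Set X}
    (hAB : A ⊆ Metric.closedBall (0 : X) 1) {ε : ℝ} (hε : 0 < ε)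
    (hA : ∀ (f : StrongDual ℝ X) (c : ℝ), (∃ x ∈ A, c < f x) →
      ε < Metric.diam {a ∈ A | c < f a})
    {η : ℝ} (hη : 0 < η) {K : Set X} (hK : IsCompact K) (ν : SliceNode X) :
    cco A ⊆ closure (convexHull ℝ
      (SliceNode.point '' {ν' | ν'.IsDeep A η ∧ ν.IsRefinement A (ε / 8) K ν'} ∪
        (cco A ∩ {z | ν.functional z ≤ ν.bound}))) := by
  intro x hx
  by_contra hxn
  obtain ⟨h, d, hhd, hdx⟩ := geometric_hahn_banach_closed_point
    (convex_convexHull ℝ _).closure isClosed_closure hxn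
  have hout := fun y hy => hhd y (subset_closure (subset_convexHull ℝ _ hy))
  obtain ⟨f, c, ⟨x₁, hx₁, hcx₁⟩, hf⟩ :=
    exists_subslice_disjoint_thickening hAB hε hA h d ⟨x, hx, hdx⟩ hK
  obtain ⟨a₀, ha₀, hca₀⟩ := exists_mem_lt_of_mem_cco hx₁ hcx₁
  have hbdd : BddAbove (f '' A) :=
    (f.lipschitz.isBounded_image (Metric.isBounded_closedBall.subset hAB)).bddAbove
  set M := sSup (f '' A) with hM
  have hAM : ∀ a ∈ A, f a ≤ M := fun a ha => le_csSup hbdd (mem_image_of_mem f ha)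
  have hcM : c < M := hca₀.trans_le (hAM a₀ ha₀)
  have hlt : max c (M - η * (M - (c + M) / 2)) < M :=
    max_lt hcM (sub_lt_self _ (mul_pos hη (by linarith)))
  obtain ⟨_, ⟨a, ha, rfl⟩, haM⟩ := exists_lt_of_lt_csSup ⟨_, mem_image_of_mem f ha₀⟩ hlt
  obtain ⟨hca, hda⟩ := max_lt_iff.mp haM
  have hda' := (hf a (subset_cco A ha) hca).1
  -- The midpoint bound leaves a gap above `c`, so separation survives the later passage to limits.
  refine absurd (hout a (Or.inl ⟨⟨a, f, (c + M) / 2⟩, ⟨⟨ha, M, hAM, ?_, ?_⟩, ?_, c, ?_, ?_⟩, rfl⟩))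
    (not_lt.mpr hda'.le)
  · change (c + M) / 2 < M
    linarith
  · change M - f a ≤ η * (M - (c + M) / 2)
    linarith
  · intro z hz hzc
    change (c + M) / 2 < f z at hzc
    by_contra! hle
    exact absurd (hout z (Or.inr ⟨hz, hle⟩)) (not_lt.mpr (hf z hz (by linarith)).1.le)
  · change c < (c + M) / 2
    linarith
  · intro z hz hzK
    by_contra! hlt
    exact (hf z hz hlt).2 hzK

/-- Depth forces the weight outside the slice below `2 * η`. Dropping that part moves the point by
at most `4 * η`, and the density approximation costs another `η`. -/
theorem SliceNode.IsDeep.exists_convexHull_refinements {A : Set X}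
    (hAB : A ⊆ Metric.closedBall (0 : X) 1) {ε : ℝ} (hε : 0 < ε)
    (hA : ∀ (f : StrongDual ℝ X) (c : ℝ), (∃ x ∈ A, c < f x) →
      ε < Metric.diam {a ∈ A | c < f a})
    {η η' : ℝ} (hη : 0 < η) (hη1 : η < 1) (hη' : 0 < η') {K : Set X} (hK : IsCompact K)
    {ν : SliceNode X} (hν : ν.IsDeep A η) :
    ∃ a ∈ convexHull ℝ
      (SliceNode.point '' {ν' | ν'.IsDeep A η' ∧ ν.IsRefinement A (ε / 8) K ν'}),
      ‖ν.point - a‖ ≤ 5 * η := by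
  have hsub := cco_subset_cco_refinements_union hAB hε hA hη' hK ν
  have hpt := hν.bound_lt hη1
  obtain ⟨hxA, M, hAM, hcM, hdeep⟩ := hν
  set f := ν.functional
  set c := ν.bound
  set x := ν.point
  set S := SliceNode.point '' {ν' | ν'.IsDeep A η' ∧ ν.IsRefinement A (ε / 8) K ν'} with hS
  have hSA : S ⊆ A := by
    rintro _ ⟨ν', hν', rfl⟩
    exact hν'.1.1
  have hCB : cco A ⊆ Metric.closedBall (0 : X) 1 :=
    cco_subset hAB (convex_closedBall _ _) Metric.isClosed_closedBall
  have hTc : Convex ℝ (cco A ∩ {z | f z ≤ c}) :=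
    (convex_cco A).inter (convex_halfSpace_le f.isLinear c)
  have hTcl : IsClosed (cco A ∩ {z | f z ≤ c}) :=
    isClosed_closure.inter (isClosed_le f.continuous continuous_const)
  have hSne : S.Nonempty := by
    by_contra hem
    rw [not_nonempty_iff_eq_empty.mp hem, empty_union, hTc.convexHull_eq,
      IsClosed.closure_eq (hTcl : IsClosed (cco A ∩ {z | f z ≤ c}))] at hsub
    exact absurd (hsub (subset_cco A hxA)).2 (not_le.mpr hpt)
  have hpos : 0 < η * (M - c) := mul_pos hη (sub_pos.mpr hcM)
  have hopen : IsOpen (Metric.ball x η ∩ {y | f x - η * (M - c) < f y}) :=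
    Metric.isOpen_ball.inter (isOpen_lt continuous_const f.continuous)
  obtain ⟨y, ⟨hyx, hfy⟩, hy⟩ := mem_closure_iff.mp (hsub (subset_cco A hxA)) _ hopen
    ⟨Metric.mem_ball_self hη, sub_lt_self _ hpos⟩
  have hyx' : ‖x - y‖ < η := by
    rw [← dist_eq_norm, dist_comm]; exact hyx
  rcases exists_of_mem_convexHull_union hSne hy with hy | ⟨a, ha, b, hb, t, ht0, ht1, rfl⟩
  · exact ⟨y, hy, by linarith⟩
  · refine ⟨a, ha, ?_⟩
    rw [hTc.convexHull_eq] at hb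
    have haC : a ∈ cco A := subset_closure (convexHull_mono hSA ha)
    have haM : f a ≤ M := by
      have : convexHull ℝ S ⊆ {z | f z ≤ M} :=
        convexHull_min (fun z hz => hAM z (hSA hz)) (convex_halfSpace_le f.isLinear M)
      exact this ha
    have h3 : f x - η * (M - c) < (1 - t) * f a + t * f b := by simpa using hfy
    have h4 : (1 - t) * f a ≤ (1 - t) * M := mul_le_mul_of_nonneg_left haM (by linarith)
    have h5 : t * f b ≤ t * c := mul_le_mul_of_nonneg_left hb.2 ht0
    have h6 : t < 2 * η := by
      have : t * (M - c) < 2 * η * (M - c) := by nlinarith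
      exact lt_of_mul_lt_mul_right this (by linarith)
    have h7 : ‖(1 - t) • a + t • b - a‖ ≤ 4 * η := by
      have : (1 - t) • a + t • b - a = t • (b - a) := by module
      rw [this, norm_smul, Real.norm_of_nonneg ht0]
      have ha1 : ‖a‖ ≤ 1 := by simpa using hCB haC
      have hb1 : ‖b‖ ≤ 1 := by simpa using hCB hb.1
      have : ‖b - a‖ ≤ 2 := (norm_sub_le _ _).trans (by linarith)
      nlinarith [norm_nonneg (b - a)]
    have := norm_sub_le_norm_sub_add_norm_sub x ((1 - t) • a + t • b) a
    linarith

end Refinement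

/-! ### Approximate bushes and their exact limits -/

section Bush

universe u

/-- Finitely many weighted nodes. -/
structure Branching (X : Type u) [NormedAddCommGroup X] [NormedSpace ℝ X] where
  ι : Type
  [fintype : Fintype ι]
  weight : ι → ℝ
  node : ι → SliceNode X

attribute [instance] Branching.fintype

variable {X : Type u} [NormedAddCommGroup X] [NormedSpace ℝ X]

/-- The weights are those of a convex combination, which approximates the point of `ν` up to
`5 * η`;
the nodes are deep refinements of `ν`. -/
structure Branching.IsGood (A : Set X) (δ η η' : ℝ) (K : Set X) (ν : SliceNode X)
    (B : Branching X) : Prop where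
  weight_nonneg : ∀ i, 0 ≤ B.weight i
  sum_weight : ∑ i, B.weight i = 1
  isDeep : ∀ i, (B.node i).IsDeep A η'
  isRefinement : ∀ i, ν.IsRefinement A δ K (B.node i)
  norm_sub_le : ‖∑ i, B.weight i • (B.node i).point - ν.point‖ ≤ 5 * η

/-- Levels of nodes, in which each node has a good branching into nodes of the next level that
stays away from the hull of the points of all levels so far. -/
structure ApproximateBush (A : Set X) (δ : ℝ) (η : ℕ → ℝ) where
  level : ℕ → Finset (SliceNode X)
  points : ℕ → Finset X
  branch : ℕ → SliceNode X → Branching X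
  level_zero_nonempty : (level 0).Nonempty
  isDeep : ∀ n, ∀ ν ∈ level n, ν.IsDeep A (η n)
  point_mem : ∀ n, ∀ ν ∈ level n, ν.point ∈ points n
  points_mono : Monotone points
  node_mem : ∀ n, ∀ ν ∈ level n, ∀ i, (branch n ν).node i ∈ level (n + 1)
  exists_parent : ∀ n, ∀ ν ∈ level (n + 1), ∃ ν₀ ∈ level n, ∃ i, (branch n ν₀).node i = ν
  isGood : ∀ n, ∀ ν ∈ level n,
    (branch n ν).IsGood A δ (η n) (η (n + 1)) (convexHull ℝ (points n)) ν

theorem SliceNode.IsDeep.exists_isGood {A : Set X}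
    (hAB : A ⊆ Metric.closedBall (0 : X) 1) {ε : ℝ} (hε : 0 < ε)
    (hA : ∀ (f : StrongDual ℝ X) (c : ℝ), (∃ x ∈ A, c < f x) →
      ε < Metric.diam {a ∈ A | c < f a})
    {η η' : ℝ} (hη : 0 < η) (hη1 : η < 1) (hη' : 0 < η') {K : Set X} (hK : IsCompact K)
    {ν : SliceNode X} (hν : ν.IsDeep A η) :
    ∃ B : Branching X, B.IsGood A (ε / 8) η η' K ν := by
  obtain ⟨a, ha, hle⟩ := hν.exists_convexHull_refinements hAB hε hA hη hη1 hη' hK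
  obtain ⟨ι, _, w, z, hw, hw1, hz, rfl⟩ := mem_convexHull_iff_exists_fintype.mp ha
  choose g hg hgz using hz
  refine ⟨⟨ι, w, g⟩, hw, hw1, fun i => (hg i).1, fun i => (hg i).2, ?_⟩
  rw [norm_sub_rev]
  simpa only [hgz] using hle

theorem exists_approximateBush {A : Set X} (hne : A.Nonempty)
    (hAB : A ⊆ Metric.closedBall (0 : X) 1) {ε : ℝ} (hε : 0 < ε)
    (hA : ∀ (f : StrongDual ℝ X) (c : ℝ), (∃ x ∈ A, c < f x) →
      ε < Metric.diam {a ∈ A | c < f a})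
    {η : ℕ → ℝ} (hη : ∀ n, 0 < η n) (hη1 : ∀ n, η n < 1) :
    Nonempty (ApproximateBush A (ε / 8) η) := by
  classical
  have hstep : ∀ (n : ℕ) (Q : Finset X) (ν : SliceNode X), ∃ B : Branching X,
      ν.IsDeep A (η n) → B.IsGood A (ε / 8) (η n) (η (n + 1)) (convexHull ℝ (Q : Set X)) ν := by
    intro n Q ν
    by_cases hν : ν.IsDeep A (η n)
    · obtain ⟨B, hB⟩ := hν.exists_isGood hAB hε hA (hη n) (hη1 n) (hη (n + 1))
        (Q.finite_toSet.isCompact_convexHull ℝ)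
      exact ⟨B, fun _ => hB⟩
    -- Default branching, only to make the choice total.
    · exact ⟨⟨Empty, Empty.elim, Empty.elim⟩, fun h => absurd h hν⟩
  choose B hB using hstep
  obtain ⟨x₀, hx₀⟩ := hne
  let next : ℕ → Finset (SliceNode X) × Finset X → Finset (SliceNode X) × Finset X := fun n s =>
    let L := s.1.biUnion fun ν => Finset.univ.image (B n s.2 ν).node
    (L, s.2 ∪ L.image SliceNode.point)
  let state : ℕ → Finset (SliceNode X) × Finset X := fun n =>
    -- The root's half-space is the whole space, and its depth holds with `M = 0`.
    Nat.rec ({⟨x₀, 0, -1⟩}, {x₀}) next n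
  have hmem : ∀ n ν, ν ∈ (state (n + 1)).1 ↔
      ∃ ν₀ ∈ (state n).1, ∃ i, (B n (state n).2 ν₀).node i = ν := by
    intro n ν
    change ν ∈ (state n).1.biUnion (fun ν => Finset.univ.image (B n (state n).2 ν).node) ↔ _
    simp
  have hdeep : ∀ n, ∀ ν ∈ (state n).1, ν.IsDeep A (η n) := by
    intro n
    induction n with
    | zero =>
      intro ν hν
      rw [show ν = ⟨x₀, 0, -1⟩ from Finset.mem_singleton.mp hν]
      exact ⟨hx₀, 0, by simp, by simp, by simpa using (hη 0).le⟩
    | succ n ih =>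
      intro ν hν
      obtain ⟨ν₀, hν₀, i, rfl⟩ := (hmem n ν).mp hν
      exact (hB n _ ν₀ (ih ν₀ hν₀)).isDeep i
  refine ⟨⟨fun n => (state n).1, fun n => (state n).2, fun n => B n (state n).2,
    ⟨_, Finset.mem_singleton_self _⟩,
    hdeep, ?_, ?_, fun n ν hν i => (hmem n _).mpr ⟨ν, hν, i, rfl⟩,
    fun n ν hν => (hmem n ν).mp hν, fun n ν hν => hB n _ ν (hdeep n ν hν)⟩⟩
  · intro n ν hν
    cases n with
    | zero =>
      rw [show ν = ⟨x₀, 0, -1⟩ from Finset.mem_singleton.mp hν]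
      exact Finset.mem_singleton_self _
    | succ n => exact Finset.mem_union_right _ (Finset.mem_image_of_mem _ hν)
  · exact monotone_nat_of_le_succ fun n => Finset.subset_union_left

namespace ApproximateBush

variable {A : Set X} {δ : ℝ} {η : ℕ → ℝ} (T : ApproximateBush A δ η)

/-- The average of the points of the nodes `k` levels below a node of level `n`. -/
noncomputable def average : ℕ → ℕ → SliceNode X → X
  | _, 0, ν => ν.point
  | n, k + 1, ν => ∑ i, (T.branch n ν).weight i • average (n + 1) k ((T.branch n ν).node i)

theorem average_mem {S : ℕ → Set X} (hS : ∀ n, Convex ℝ (S n))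
    (hpt : ∀ n, ∀ ν ∈ T.level n, ν.point ∈ S n) {n k : ℕ} {ν : SliceNode X}
    (hν : ν ∈ T.level n) : T.average n k ν ∈ S (n + k) := by
  induction k generalizing n ν with
  | zero => exact hpt n ν hν
  | succ k ih =>
    have hg := T.isGood n ν hν
    refine (hS _).sum_mem (fun i _ => hg.weight_nonneg i) hg.sum_weight fun i _ => ?_
    rw [show n + (k + 1) = n + 1 + k by omega]
    exact ih (T.node_mem n ν hν i)

theorem point_mem_set {n : ℕ} {ν : SliceNode X} (hν : ν ∈ T.level n) : ν.point ∈ A :=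
  (T.isDeep n ν hν).1

theorem average_mem_cco {n k : ℕ} {ν : SliceNode X} (hν : ν ∈ T.level n) :
    T.average n k ν ∈ cco A :=
  T.average_mem (S := fun _ => cco A) (fun _ => convex_cco A)
    (fun _ _ h => subset_cco A (T.point_mem_set h)) hν

theorem average_mem_convexHull {n k : ℕ} {ν : SliceNode X} (hν : ν ∈ T.level n) :
    T.average n k ν ∈ convexHull ℝ (T.points (n + k) : Set X) :=
  T.average_mem (S := fun n => convexHull ℝ (T.points n : Set X))
    (fun _ => convex_convexHull ℝ _) (fun n ν h => subset_convexHull ℝ _ (T.point_mem n ν h)) hν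

theorem bound_lt_average (hη1 : ∀ n, η n < 1) {n k : ℕ} {ν : SliceNode X}
    (hν : ν ∈ T.level n) : ν.bound < ν.functional (T.average n k ν) := by
  induction k generalizing n ν with
  | zero => exact (T.isDeep n ν hν).bound_lt (hη1 n)
  | succ k ih =>
    have hg := T.isGood n ν hν
    refine (convex_halfSpace_gt ν.functional.isLinear ν.bound).sum_mem
      (fun i _ => hg.weight_nonneg i) hg.sum_weight fun i _ => ?_
    have hi := T.node_mem n ν hν i
    exact (hg.isRefinement i).1 _ (T.average_mem_cco hi) (ih hi)

/-- Only the branchings at level `n + k` differ between the two averages, and convex weights do not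
amplify their errors. -/
theorem dist_average_succ_le {n k : ℕ} {ν : SliceNode X} (hν : ν ∈ T.level n) :
    dist (T.average n k ν) (T.average n (k + 1) ν) ≤ 5 * η (n + k) := by
  induction k generalizing n ν with
  | zero =>
    rw [dist_comm, dist_eq_norm]
    exact (T.isGood n ν hν).norm_sub_le
  | succ k ih =>
    have hg := T.isGood n ν hν
    rw [dist_eq_norm]
    calc ‖T.average n (k + 1) ν - T.average n (k + 1 + 1) ν‖
        = ‖∑ i, (T.branch n ν).weight i • (T.average (n + 1) k ((T.branch n ν).node i) -
            T.average (n + 1) (k + 1) ((T.branch n ν).node i))‖ := by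
          simp only [smul_sub, Finset.sum_sub_distrib]
          rfl
      _ ≤ ∑ i, (T.branch n ν).weight i * (5 * η (n + (k + 1))) := by
          refine norm_sum_le_of_le _ fun i _ => ?_
          rw [norm_smul, Real.norm_of_nonneg (hg.weight_nonneg i), ← dist_eq_norm,
            show n + (k + 1) = n + 1 + k by omega]
          exact mul_le_mul_of_nonneg_left (ih (T.node_mem n ν hν i)) (hg.weight_nonneg i)
      _ = 5 * η (n + (k + 1)) := by rw [← Finset.sum_mul, hg.sum_weight, one_mul]

/-- The exact bush: the limits of the averages. -/
noncomputable def value (n : ℕ) (ν : SliceNode X) : X :=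
  limUnder atTop fun k => T.average n k ν

section Geometric

variable {κ : ℝ} {T : ApproximateBush A δ fun n => κ / 2 / 2 ^ n}

theorem dist_average_succ_le_geometric {n : ℕ} {ν : SliceNode X} (hν : ν ∈ T.level n) (k : ℕ) :
    dist (T.average n k ν) (T.average n (k + 1) ν) ≤ 5 * κ / 2 ^ n / 2 / 2 ^ k := by
  refine (T.dist_average_succ_le hν).trans_eq ?_
  rw [pow_add]
  field_simp

theorem tendsto_average [CompleteSpace X] {n : ℕ} {ν : SliceNode X} (hν : ν ∈ T.level n) :
    Tendsto (fun k => T.average n k ν) atTop (𝓝 (T.value n ν)) :=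
  (cauchySeq_of_le_geometric_two (dist_average_succ_le_geometric hν)).tendsto_limUnder

theorem dist_point_value_le [CompleteSpace X] {n : ℕ} {ν : SliceNode X} (hν : ν ∈ T.level n) :
    dist ν.point (T.value n ν) ≤ 5 * κ / 2 ^ n :=
  dist_le_of_le_geometric_two_of_tendsto₀ (dist_average_succ_le_geometric hν) (tendsto_average hν)

theorem value_eq_sum [CompleteSpace X] {n : ℕ} {ν : SliceNode X} (hν : ν ∈ T.level n) :
    T.value n ν =
      ∑ i, (T.branch n ν).weight i • T.value (n + 1) ((T.branch n ν).node i) := by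
  refine tendsto_nhds_unique ((tendsto_add_atTop_iff_nat 1).mpr (tendsto_average hν)) ?_
  exact tendsto_finsetSum _ fun i _ => (tendsto_average (T.node_mem n ν hν i)).const_smul _

theorem value_mem_cco [CompleteSpace X] {n : ℕ} {ν : SliceNode X} (hν : ν ∈ T.level n) :
    T.value n ν ∈ cco A :=
  isClosed_closure.mem_of_tendsto (tendsto_average hν)
    (Eventually.of_forall fun _ => T.average_mem_cco hν)

theorem bound_le_value [CompleteSpace X] (hκ1 : κ ≤ 1) {n : ℕ} {ν : SliceNode X}
    (hν : ν ∈ T.level n) : ν.bound ≤ ν.functional (T.value n ν) := by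
  refine ge_of_tendsto' ((ν.functional.continuous.tendsto _).comp (tendsto_average hν)) fun k =>
    (T.bound_lt_average (fun n => ?_) hν).le
  have : (1 : ℝ) ≤ 2 ^ n := one_le_pow₀ one_le_two
  rw [div_lt_one (by positivity)]
  linarith

/-- The set of all values of the exact bush. -/
def values (T : ApproximateBush A δ fun n => κ / 2 / 2 ^ n) : Set X :=
  ⋃ n, T.value n '' T.level n

theorem finite_iUnion_image (T : ApproximateBush A δ fun n => κ / 2 / 2 ^ n) (N : ℕ) :
    (⋃ n ∈ Set.Iio N, T.value n '' T.level n).Finite :=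
  (Set.finite_Iio N).biUnion fun n _ => (T.level n).finite_toSet.image _

theorem mem_convexHull_values_diff [CompleteSpace X] (hκ0 : 0 < κ) (hκ1 : κ ≤ 1)
    (hκδ : 5 * κ < δ) {y : X} (hy : y ∈ T.values) : y ∈ convexHull ℝ (T.values \ {y}) := by
  obtain ⟨n, ν, hν, rfl⟩ := mem_iUnion.mp hy
  have hν : ν ∈ T.level n := hν
  have hg := T.isGood n ν hν
  rw [value_eq_sum hν]
  refine (convex_convexHull ℝ _).sum_mem (fun i _ => hg.weight_nonneg i) hg.sum_weight
    fun i _ => subset_convexHull ℝ _ ⟨?_, ?_⟩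
  · exact mem_iUnion.mpr ⟨n + 1, _, T.node_mem n ν hν i, rfl⟩
  · rw [← value_eq_sum hν]
    intro heq
    have heq : T.value (n + 1) ((T.branch n ν).node i) = T.value n ν := heq
    obtain ⟨-, d, hd, hK⟩ := hg.isRefinement i
    -- The parent's value is still within `δ` of its original point, so every child's half-space
    -- excludes it.
    have hthick : T.value n ν ∈ Metric.thickening δ (convexHull ℝ (T.points n : Set X)) := by
      refine Metric.mem_thickening_iff.mpr
        ⟨ν.point, subset_convexHull ℝ _ (T.point_mem n ν hν), ?_⟩
      rw [dist_comm]
      refine (dist_point_value_le hν).trans_lt (lt_of_le_of_lt ?_ hκδ)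
      exact div_le_self (by linarith) (one_le_pow₀ one_le_two)
    have h1 := hK _ (value_mem_cco hν) hthick
    have h2 := bound_le_value hκ1 (T.node_mem n ν hν i)
    rw [heq] at h2
    linarith

theorem exists_ancestor {m n : ℕ} (hmn : m ≤ n) {ν : SliceNode X} (hν : ν ∈ T.level n) :
    ∃ ν₀ ∈ T.level m, ∀ z ∈ cco A, ν.bound < ν.functional z → ν₀.bound < ν₀.functional z := by
  induction n, hmn using Nat.le_induction generalizing ν with
  | base => exact ⟨ν, hν, fun _ _ h => h⟩
  | succ n _ ih =>
    obtain ⟨ν₁, hν₁, i, rfl⟩ := T.exists_parent n ν hν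
    obtain ⟨ν₀, hν₀, h⟩ := ih hν₁
    exact ⟨ν₀, hν₀, fun z hz hlt => h z hz (((T.isGood n ν₁ hν₁).isRefinement i).1 z hz hlt)⟩

theorem exists_ancestor_bound_le_value [CompleteSpace X] (hκ1 : κ ≤ 1) {m n : ℕ}
    (hmn : m ≤ n) {ν : SliceNode X} (hν : ν ∈ T.level n) :
    ∃ ν₀ ∈ T.level m, ν₀.bound ≤ ν₀.functional (T.value n ν) := by
  obtain ⟨ν₀, hν₀, h⟩ := exists_ancestor hmn hν
  refine ⟨ν₀, hν₀, ge_of_tendsto' ((ν₀.functional.continuous.tendsto _).comp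
    (tendsto_average hν)) fun k => (h _ (T.average_mem_cco hν) ?_).le⟩
  refine T.bound_lt_average (fun n => ?_) hν
  have : (1 : ℝ) ≤ 2 ^ n := one_le_pow₀ one_le_two
  rw [div_lt_one (by positivity)]
  linarith

/-- Every point has a weak neighborhood that meets the values in a finite set. -/
theorem exists_weak_nhds_finite_inter [CompleteSpace X] (hκ1 : κ ≤ 1)
    (hδ : 0 < δ) (z : WeakSpace ℝ X) :
    ∃ U ∈ 𝓝 z, (U ∩ toWeakSpace ℝ X '' T.values).Finite := by
  obtain ⟨z, rfl⟩ := (toWeakSpace ℝ X).surjective z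
  -- All averages lie in `H`, so a point outside `closure H` is already weakly separated from the
  -- values; any other point is within `δ` of the hull at some finite stage.
  set H : Set X := ⋃ n, convexHull ℝ (T.points n : Set X) with hH
  have hHmono : Monotone fun n => convexHull ℝ (T.points n : Set X) := fun m n hmn =>
    convexHull_mono (Finset.coe_subset.mpr (T.points_mono hmn))
  have hHc : Convex ℝ H :=
    (hHmono.directed_le).convex_iUnion fun n => convex_convexHull ℝ _
  have hFH : T.values ⊆ closure H := by
    rintro y hy
    obtain ⟨n, ν, hν, rfl⟩ := mem_iUnion.mp hy
    exact mem_closure_of_tendsto (tendsto_average hν)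
      (Eventually.of_forall fun k => mem_iUnion.mpr ⟨n + k, T.average_mem_convexHull hν⟩)
  have hweak : ∀ E : Set X, Convex ℝ E → IsClosed (toWeakSpace ℝ X '' closure E) := fun E hE => by
    rw [hE.toWeakSpace_closure ℝ]
    exact isClosed_closure
  have hempty : ∀ E : Set X, Convex ℝ E → T.values ⊆ closure E → z ∉ closure E →
      ∃ U ∈ 𝓝 (toWeakSpace ℝ X z), (U ∩ toWeakSpace ℝ X '' T.values).Finite := by
    intro E hE hsub hz
    refine ⟨_, (hweak E hE).compl_mem_nhds
      (mt (toWeakSpace ℝ X).injective.mem_set_image.mp hz), ?_⟩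
    convert Set.finite_empty
    rw [← Set.disjoint_iff_inter_eq_empty, Set.disjoint_compl_left_iff_subset]
    exact image_mono hsub
  by_cases hzA : z ∈ cco A
  swap
  · refine hempty _ (convex_convexHull ℝ A) (fun y hy => ?_) hzA
    obtain ⟨n, ν, hν, rfl⟩ := mem_iUnion.mp hy
    exact value_mem_cco hν
  by_cases hzH : z ∈ closure H
  swap
  · exact hempty H hHc hFH hzH
  obtain ⟨h, hhH, hzh⟩ := Metric.mem_closure_iff.mp hzH δ hδ
  obtain ⟨m, hm⟩ := mem_iUnion.mp hhH
  have hzthick : z ∈ Metric.thickening δ (convexHull ℝ (T.points m : Set X)) :=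
    Metric.mem_thickening_iff.mpr ⟨h, hm, hzh⟩
  refine ⟨⋂ ν ∈ T.level (m + 1), {w | ν.functional ((toWeakSpace ℝ X).symm w) < ν.bound},
    (Filter.biInter_finset_mem _).mpr fun ν hν => ?_,
    ((finite_iUnion_image T (m + 1)).image (toWeakSpace ℝ X)).subset ?_⟩
  · have hcont : Continuous fun w : WeakSpace ℝ X => ν.functional ((toWeakSpace ℝ X).symm w) :=
      WeakBilin.eval_continuous _ ν.functional
    refine (isOpen_lt hcont continuous_const).mem_nhds ?_
    obtain ⟨ν₀, hν₀, i, rfl⟩ := T.exists_parent m ν hν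
    obtain ⟨-, d, hd, hK⟩ := (T.isGood m ν₀ hν₀).isRefinement i
    exact (hK z hzA hzthick).trans_lt hd
  · rintro _ ⟨hU, y, hy, rfl⟩
    refine mem_image_of_mem _ ?_
    obtain ⟨n, ν, hν, rfl⟩ := mem_iUnion.mp hy
    rcases lt_or_ge n (m + 1) with hn | hn
    · exact mem_biUnion hn ⟨ν, hν, rfl⟩
    · obtain ⟨ν₀, hν₀, hle⟩ := exists_ancestor_bound_le_value hκ1 hn hν
      exact absurd (mem_iInter₂.mp hU ν₀ hν₀) (not_lt.mpr hle)

theorem tendsto_infDist_values [CompleteSpace X] :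
    Tendsto (fun x : T.values => Metric.infDist (x : X) A) cofinite (𝓝 0) := by
  rw [Metric.tendsto_nhds]
  intro e he
  have hlim : Tendsto (fun n : ℕ => 5 * κ / 2 ^ n) atTop (𝓝 0) :=
    tendsto_const_nhds.div_atTop (tendsto_pow_atTop_atTop_of_one_lt one_lt_two)
  obtain ⟨N, hN⟩ := eventually_atTop.mp (hlim.eventually_lt_const he)
  rw [Filter.eventually_cofinite]
  refine ((finite_iUnion_image T N).preimage Subtype.val_injective.injOn).subset ?_
  rintro ⟨y, hy⟩ hfar
  obtain ⟨n, ν, hν, rfl⟩ := mem_iUnion.mp hy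
  rcases lt_or_ge n N with hn | hn
  · exact mem_biUnion hn ⟨ν, hν, rfl⟩
  · refine absurd ?_ hfar
    rw [Real.dist_0_eq_abs, abs_of_nonneg Metric.infDist_nonneg]
    refine (Metric.infDist_le_dist_of_mem (T.point_mem_set hν)).trans_lt ?_
    rw [dist_comm]
    exact (dist_point_value_le hν).trans_lt (hN n hn)

end Geometric

end ApproximateBush

end Bush

/-! ### Milman's theorem -/

section Milman

variable {V : Type*} [AddCommGroup V] [Module ℝ V] [TopologicalSpace V]

/-- Finitely many closed convex sets that miss an extreme point `e` of a compact convex set `W`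
have their traces on `W` contained in one compact convex set missing `e`. -/
theorem exists_isCompact_convex_notMem_of_mem_extremePoints [IsTopologicalAddGroup V]
    [ContinuousSMul ℝ V] {W : Set V} (hW : IsCompact W) (hWc : Convex ℝ W) {e : V}
    (he : e ∈ W.extremePoints ℝ) {ι : Type*} (s : Finset ι) (N : ι → Set V)
    (hN : ∀ i ∈ s, IsClosed (N i) ∧ Convex ℝ (N i) ∧ e ∉ N i) :
    ∃ D ⊆ W, IsCompact D ∧ Convex ℝ D ∧ e ∉ D ∧ ∀ i ∈ s, W ∩ N i ⊆ D := by
  classical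
  induction s using Finset.induction_on with
  | empty => exact ⟨∅, empty_subset _, isCompact_empty, convex_empty, notMem_empty _, by simp⟩
  | insert i s _ ih =>
    obtain ⟨D, hDW, hDk, hDc, heD, hD⟩ := ih fun j hj => hN j (Finset.mem_insert_of_mem hj)
    obtain ⟨hNcl, hNc, heN⟩ := hN i (Finset.mem_insert_self _ _)
    have hWN : IsCompact (W ∩ N i) := hW.inter_right hNcl
    have hWNc : Convex ℝ (W ∩ N i) := hWc.inter hNc
    rcases D.eq_empty_or_nonempty with rfl | hDne
    · refine ⟨W ∩ N i, inter_subset_left, hWN, hWNc, fun h => heN h.2, fun j hj => ?_⟩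
      rcases Finset.mem_insert.mp hj with rfl | hj
      · exact subset_rfl
      · exact (hD j hj).trans (empty_subset _)
    rcases (W ∩ N i).eq_empty_or_nonempty with hem | hne
    · refine ⟨D, hDW, hDk, hDc, heD, fun j hj => ?_⟩
      rcases Finset.mem_insert.mp hj with rfl | hj
      · rw [hem]; exact empty_subset _
      · exact hD j hj
    -- Writing the join as a continuous image of a compact product gives its compactness.
    have hjoin : convexJoin ℝ D (W ∩ N i) =
        (fun p : ℝ × V × V => (1 - p.1) • p.2.1 + p.1 • p.2.2) ''
          (Icc 0 1 ×ˢ D ×ˢ (W ∩ N i)) := by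
      ext x
      rw [mem_convexJoin]
      constructor
      · rintro ⟨a, ha, b, hb, hx⟩
        rw [segment_eq_image] at hx
        obtain ⟨t, ht, rfl⟩ := hx
        exact ⟨(t, a, b), ⟨ht, ha, hb⟩, rfl⟩
      · rintro ⟨⟨t, a, b⟩, ⟨ht, ha, hb⟩, rfl⟩
        refine ⟨a, ha, b, hb, ?_⟩
        rw [segment_eq_image]
        exact ⟨t, ht, rfl⟩
    refine ⟨convexJoin ℝ D (W ∩ N i), convexJoin_subset hDW inter_subset_left hWc, ?_,
      hDc.convexJoin hWNc, ?_, fun j hj => ?_⟩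
    · rw [hjoin]
      exact (isCompact_Icc.prod (hDk.prod hWN)).image (by fun_prop)
    · intro hej
      obtain ⟨a, ha, b, hb, hx⟩ := mem_convexJoin.mp hej
      rcases (mem_extremePoints_iff_forall_segment.mp he).2 a (hDW ha) b hb.1 hx with rfl | rfl
      · exact heD ha
      · exact heN hb.2
    · rcases Finset.mem_insert.mp hj with rfl | hj
      · exact subset_convexJoin_right hDne
      · exact (hD j hj).trans (subset_convexJoin_left hne)

/-- **Milman's theorem**: the extreme points of a compact closed convex hull `cco G` lie in the
closure of `G`. -/
theorem extremePoints_cco_subset_closure [IsTopologicalAddGroup V] [ContinuousSMul ℝ V]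
    [LocallyConvexSpace ℝ V] [T2Space V] {G : Set V} (hG : IsCompact (cco G)) :
    (cco G).extremePoints ℝ ⊆ closure G := by
  intro e he
  by_contra hne
  have hWc : Convex ℝ (cco G) := (convex_convexHull ℝ G).closure
  have hGW : closure G ⊆ cco G := closure_mono (subset_convexHull ℝ G)
  have hGk : IsCompact (closure G) := hG.of_isClosed_subset isClosed_closure hGW
  have hsep : ∀ k : V, ∃ p : StrongDual ℝ V × ℝ, k ∈ closure G → p.1 k < p.2 ∧ p.2 < p.1 e := by
    intro k
    by_cases hk : k ∈ closure G
    · obtain ⟨f, hf⟩ := geometric_hahn_banach_point_point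
        (x := k) (y := e) (fun h => hne (h ▸ hk))
      obtain ⟨c, hc1, hc2⟩ := exists_between hf
      exact ⟨(f, c), fun _ => ⟨hc1, hc2⟩⟩
    · exact ⟨0, fun h => absurd h hk⟩
  choose p hp using hsep
  obtain ⟨t, htG, htc⟩ := hGk.elim_nhds_subcover (fun k => {z | (p k).1 z ≤ (p k).2}) fun k hk =>
    mem_of_superset ((isOpen_lt (p k).1.continuous continuous_const).mem_nhds (hp k hk).1)
      fun z hz => le_of_lt (show (p k).1 z < (p k).2 from hz)
  obtain ⟨D, hDW, hDk, hDc, heD, hD⟩ :=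
    exists_isCompact_convex_notMem_of_mem_extremePoints hG hWc he t
      (fun k => {z | (p k).1 z ≤ (p k).2}) fun k hk =>
      ⟨isClosed_le (p k).1.continuous continuous_const,
        convex_halfSpace_le (p k).1.isLinear _, not_le.mpr (hp k (htG k hk)).2⟩
  have hGD : G ⊆ D := fun z hz => by
    obtain ⟨k, hk, hzk⟩ := mem_iUnion₂.mp (htc (subset_closure hz))
    exact hD k hk ⟨hGW (subset_closure hz), hzk⟩
  exact heD (closure_minimal (convexHull_min hGD hDc) hDk.isClosed he.1)

end Milman

/-! ### Weakly closed discrete sets without extreme points -/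

section WeaklyDiscrete

/-- A weakly closed set `F` such that every point of `F` is in the hull of the others is avoided
by the extreme points of the weak-star closed hull in the bidual. -/
theorem image_cco_inter_extremePoints_eq_empty {X : Type*} [NormedAddCommGroup X]
    [NormedSpace ℝ X] {F : Set X} (hb : Bornology.IsBounded F)
    (hcl : IsClosed (toWeakSpace ℝ X '' F)) (hF : hullExtremePoints F = ∅) :
    ((fun x : X => StrongDual.toWeakDual (NormedSpace.inclusionInDoubleDual ℝ X x)) '' cco F) ∩
      (cco ((fun x : X =>
        StrongDual.toWeakDual (NormedSpace.inclusionInDoubleDual ℝ X x)) '' F)).extremePoints ℝ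
      = ∅ := by
  set J : X →ₗ[ℝ] WeakDual ℝ (StrongDual ℝ X) :=
    (StrongDual.toWeakDual (𝕜 := ℝ) (E := StrongDual ℝ X)).toLinearMap ∘ₗ
      (NormedSpace.inclusionInDoubleDual ℝ X).toLinearMap with hJ
  change (J '' cco F) ∩ (cco (J '' F)).extremePoints ℝ = ∅
  have hJinj : Function.Injective J := StrongDual.toWeakDual.injective.comp
    (NormedSpace.inclusionInDoubleDualLi (𝕜 := ℝ) (E := X)).injective
  rw [eq_empty_iff_forall_notMem]
  rintro _ ⟨⟨x, -, rfl⟩, he⟩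
  have hcomp : IsCompact (cco (J '' F)) := by
    refine WeakDual.isCompact_of_bounded_of_closed (WeakDual.isBounded_closure ?_)
      isClosed_closure
    rw [← J.image_convexHull]
    exact (NormedSpace.inclusionInDoubleDualLi (E := X) ℝ).lipschitz.isBounded_image
      (isBounded_convexHull.mpr hb)
  have : LocallyConvexSpace ℝ (WeakDual ℝ (StrongDual ℝ X)) := by
    have h := @WeakBilin.locallyConvexSpace ℝ (StrongDual ℝ (StrongDual ℝ X)) (StrongDual ℝ X)
      _ _ _ _ _ _ _ _ (topDualPairing ℝ (StrongDual ℝ X))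
    exact h
  have hcl' : J x ∈ closure (J '' F) := extremePoints_cco_subset_closure hcomp he
  have hxF : x ∈ F := by
    have hemb := NormedSpace.isEmbedding_inclusionInDoubleDualWeak ℝ X
    have : toWeakSpace ℝ X x ∈ closure (toWeakSpace ℝ X '' F) := by
      rw [hemb.closure_eq_preimage_closure_image, image_image]
      exact hcl'
    rw [hcl.closure_eq] at this
    exact (toWeakSpace ℝ X).injective.mem_set_image.mp this
  have : x ∈ hullExtremePoints F := by
    refine ⟨hxF, subset_convexHull ℝ F hxF, fun a ha b hb hab => ?_⟩
    have hmem : ∀ z ∈ convexHull ℝ F, J z ∈ cco (J '' F) := fun z hz => by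
      refine subset_closure ?_
      rw [← J.image_convexHull]
      exact mem_image_of_mem J hz
    refine hJinj (he.2 (hmem a ha) (hmem b hb) ?_)
    obtain ⟨s, t, hs, ht, hst, rfl⟩ := hab
    exact ⟨s, t, hs, ht, hst, by rw [map_add, map_smul, map_smul]⟩
  rw [hF] at this
  exact this

theorem hullExtremePoints_eq_empty {V : Type*} [AddCommGroup V] [Module ℝ V] {F : Set V}
    (h : ∀ y ∈ F, y ∈ convexHull ℝ (F \ {y})) : hullExtremePoints F = ∅ := by
  rw [eq_empty_iff_forall_notMem]
  rintro y ⟨hyF, hy⟩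
  rw [(convex_convexHull ℝ F).mem_extremePoints_iff_mem_sdiff_convexHull_sdiff] at hy
  exact hy.2 (convexHull_mono (sdiff_subset_sdiff_left (subset_convexHull ℝ F)) (h y hyF))

/-- The hull of a finite set is compact, so it has an extreme point, which must belong to the set.
-/
theorem infinite_of_hullExtremePoints_eq_empty {X : Type*} [NormedAddCommGroup X]
    [NormedSpace ℝ X] {F : Set X} (hne : F.Nonempty) (h : hullExtremePoints F = ∅) :
    F.Infinite := by
  intro hfin
  obtain ⟨e, he⟩ := (hfin.isCompact_convexHull ℝ).extremePoints_nonempty (hne.convexHull (𝕜 := ℝ))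
  have : e ∈ hullExtremePoints F := ⟨extremePoints_convexHull_subset he, he⟩
  rw [h] at this
  exact this

theorem isClosed_and_isDiscrete_of_finite_inter {Y : Type*} [TopologicalSpace Y] [T1Space Y]
    {G : Set Y} (h : ∀ z : Y, ∃ U ∈ 𝓝 z, (U ∩ G).Finite) : IsClosed G ∧ IsDiscrete G := by
  rw [isClosed_and_discrete_iff]
  intro z
  obtain ⟨U, hU, hfin⟩ := h z
  rw [disjoint_principal_right]
  have h1 : ((U ∩ G) \ {z})ᶜ ∈ 𝓝 z :=
    (hfin.subset sdiff_subset).isClosed.compl_mem_nhds (by simp)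
  filter_upwards [nhdsWithin_le_nhds hU, nhdsWithin_le_nhds h1, self_mem_nhdsWithin]
    with w hw1 hw2 hw3 hw4
  exact hw2 ⟨⟨hw1, hw4⟩, hw3⟩

/-- The closed convex hull of a closed discrete set whose points lie in the hull of the other
points has no denting point. -/
theorem not_isDentingPoint_cco {V : Type*} [AddCommGroup V] [Module ℝ V] [TopologicalSpace V]
    {G : Set V} (hcl : IsClosed G) (hd : IsDiscrete G)
    (h : ∀ y ∈ G, y ∈ convexHull ℝ (G \ {y})) (e : V) : ¬ IsDentingPoint (cco G) e := by
  rintro ⟨he, hdent⟩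
  have hG : G ⊆ cco G := (subset_convexHull ℝ G).trans subset_closure
  by_cases heG : e ∈ G
  · obtain ⟨U, hU, hUG⟩ := isDiscrete_iff_forall_mem_exists_isOpen.mp hd e heG
    have heU : e ∈ U := (hUG.symm.subset rfl).1
    refine hdent U (hU.mem_nhds heU) (subset_closure (convexHull_mono ?_ (h e heG)))
    exact fun y hy => ⟨hG hy.1, fun hyU => hy.2 (hUG.subset ⟨hyU, hy.1⟩)⟩
  · refine hdent Gᶜ (hcl.compl_mem_nhds heG) (closure_mono (convexHull_mono ?_) he)
    exact fun y hy => ⟨hG hy, fun h => h hy⟩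

end WeaklyDiscrete
theorem mainTheorem4 {X : Type*} [NormedAddCommGroup X] [NormedSpace ℝ X] [CompleteSpace X]
    (A : Set X) (hAB : A ⊆ Metric.closedBall (0 : X) 1) (hne : A.Nonempty)
    (hA : ¬ IsDentable A) :
    ∃ F : Set X, F.Countable ∧ F.Infinite ∧ F ⊆ cco A ∧
      -- the distance to `A` tends to `0` as a point of `F` leaves every finite subset of `F`
      Tendsto (fun x : F => Metric.infDist (x : X) A) cofinite (𝓝 0) ∧
      -- `F` is closed and discrete in the weak topology, and has no extreme points
      IsClosed (toWeakSpace ℝ X '' F) ∧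
      IsDiscrete (toWeakSpace ℝ X '' F) ∧
      hullExtremePoints F = ∅ ∧
      -- the closed convex hull of `F` has no weak denting point
      (∀ e : WeakSpace ℝ X, ¬ IsDentingPoint (toWeakSpace ℝ X '' cco F) e) ∧
      -- the closed convex hull of `F` contains no extreme point of the weak*-closed convex hull
      -- of `F` in the bidual
      ((fun x : X => StrongDual.toWeakDual (NormedSpace.inclusionInDoubleDual ℝ X x)) '' cco F) ∩
        (cco ((fun x : X =>
          StrongDual.toWeakDual (NormedSpace.inclusionInDoubleDual ℝ X x)) '' F)).extremePoints ℝ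
        = ∅ := by
  obtain ⟨ε, hε, hdiam⟩ :=
    exists_lt_diam_of_not_isDentable hA (Metric.isBounded_closedBall.subset hAB)
  -- The total displacement of a value from its point is at most `5 * κ`, which must stay below the
  -- margin `ε / 8`.
  obtain ⟨κ, hκ0, hκ⟩ : ∃ κ : ℝ, 0 < κ ∧ κ < min 1 (ε / 8 / 5) :=
    exists_between (lt_min one_pos (by positivity))
  have hκ1 : κ ≤ 1 := (hκ.trans_le (min_le_left _ _)).le
  have hκδ : 5 * κ < ε / 8 := by
    have := hκ.trans_le (min_le_right _ _)
    linarith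
  have hpow : ∀ n : ℕ, (1 : ℝ) ≤ 2 ^ n := fun n => one_le_pow₀ one_le_two
  obtain ⟨T⟩ := exists_approximateBush hne hAB hε hdiam (η := fun n => κ / 2 / 2 ^ n)
    (fun n => by positivity) fun n => by
      rw [div_lt_one (by positivity)]
      linarith [hpow n]
  have hFA : T.values ⊆ cco A := by
    rintro y hy
    obtain ⟨n, ν, hν, rfl⟩ := mem_iUnion.mp hy
    exact ApproximateBush.value_mem_cco hν
  have hFne : T.values.Nonempty := by
    obtain ⟨ν, hν⟩ := T.level_zero_nonempty
    exact ⟨_, mem_iUnion.mpr ⟨0, ν, hν, rfl⟩⟩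
  have hmem : ∀ y ∈ T.values, y ∈ convexHull ℝ (T.values \ {y}) := fun y hy =>
    ApproximateBush.mem_convexHull_values_diff hκ0 hκ1 hκδ hy
  have hext := hullExtremePoints_eq_empty hmem
  obtain ⟨hcl, hdisc⟩ := isClosed_and_isDiscrete_of_finite_inter
    (ApproximateBush.exists_weak_nhds_finite_inter (T := T) hκ1 (by positivity))
  have hFb : Bornology.IsBounded T.values := Metric.isBounded_closedBall.subset
    (hFA.trans (cco_subset hAB (convex_closedBall _ _) Metric.isClosed_closedBall))
  refine ⟨T.values, ?_, infinite_of_hullExtremePoints_eq_empty hFne hext, hFA,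
    ApproximateBush.tendsto_infDist_values, hcl, hdisc, hext, fun e => ?_,
    image_cco_inter_extremePoints_eq_empty hFb hcl hext⟩
  · exact countable_iUnion fun n => ((T.level n).finite_toSet.image _).countable
  -- Mazur's theorem: norm and weak closures of a convex set agree.
  · have himg : toWeakSpace ℝ X '' cco T.values = cco (toWeakSpace ℝ X '' T.values) := by
      unfold cco
      rw [(convex_convexHull ℝ T.values).toWeakSpace_closure ℝ]
      congr 1
      exact (toWeakSpace ℝ X).toLinearMap.image_convexHull T.values
    rw [himg]
    refine not_isDentingPoint_cco hcl hdisc ?_ e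
    rintro _ ⟨y, hy, rfl⟩
    have h := mem_image_of_mem (toWeakSpace ℝ X).toLinearMap (hmem y hy)
    rw [(toWeakSpace ℝ X).toLinearMap.image_convexHull] at h
    refine convexHull_mono ?_ h
    rintro _ ⟨w, hw, rfl⟩
    exact ⟨mem_image_of_mem _ hw.1, fun heq => hw.2 ((toWeakSpace ℝ X).injective heq)⟩
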